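/- Let $(R,\mathfrak m)$ be a Cohen-Macaulay local ring (in particular Noetherian) of dimension $d\ge 0$, and suppose that $R$ possesses a canonical module $\mathrm K_R$, that is, a maximal Cohen-Macaulay $R$-module of finite injective dimension and of Cohen-Macaulay type one. Here a finitely generated $R$-module $M\neq 0$ is called maximal Cohen-Macaulay if $\operatorname{depth}_R M=d$, and its Cohen-Macaulay type is $\mathrm r_R(M)=\ell_R\bigl(\operatorname{Ext}^d_R(R/\mathfrak m,M)\bigr)$, where $\ell_R$ denotes length. Let $M$ be a maximal Cohen-Macaulay $R$-module. Let $R\ltimes M$ denote the idealization of $M$ over $R$, i.e. the local ring with additive group $R\oplus M$ and multiplication $(a,x)(b,y)=(ab,\,ay+bx)$, and let $\mathrm r(R\ltimes M)$ denote its Cohen-Macaulay type as a module over itself: $\mathrm r(A)=\ell_A\bigl(\operatorname{Ext}^{\dim A}_A(A/\mathfrak n,A)\bigr)$ for $A=R\ltimes M$ with maximal ideal $\mathfrak n$. Then the following conditions are equivalent. 1. $\mathrm r(R\ltimes M)=\mathrm r_R(M)$. 2. The evaluation homomorphism $t\colon \operatorname{Hom}_R(M,\mathrm K_R)\otimes_R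 M\to \mathrm K_R$, $t(f\otimes x)=f(x)$, is surjective. 3. $M$ is residually faithful, i.e. $M/\mathfrak qM$ is a faithful $R/\mathfrak q$-module for some parameter ideal $\mathfrak q$ of $R$ (an ideal generated by $d$ elements whose radical is $\mathfrak m$). -/

import Mathlib

universe u

noncomputable section

open CategoryTheory TensorProduct

namespace CMType

/-- The idealization (trivial extension) `R ⋉ M` of an `R`-module `M` over a commutative ring `R`,
with `(a, x) * (b, y) = (a * b, a • y + b • x)`.  It is Mathlib's `TrivSqZeroExt R M`, where `M`
is given the right `R`-action that agrees with its left `R`-action. -/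
def Idealization (R M : Type u) : Type u := TrivSqZeroExt R M

section Idealization

variable (R M : Type u) [CommRing R] [AddCommGroup M] [Module R M]

instance instCommRingIdealization : CommRing (Idealization R M) :=
  letI : Module Rᵐᵒᵖ M := Module.compHom M ((RingHom.id R).fromOpposite mul_comm)
  haveI : IsCentralScalar R M := ⟨fun _ _ => rfl⟩
  inferInstanceAs (CommRing (TrivSqZeroExt R M))

variable {R M}

/-- The element `(a, x)` of `R ⋉ M`. -/
def Idealization.mk (a : R) (x : M) : Idealization R M := (a, x)

theorem Idealization.mk_mul_mk (a b : R) (x y : M) :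
    Idealization.mk a x * Idealization.mk b y = Idealization.mk (a * b) (a • y + b • x) := rfl

theorem Idealization.mk_add_mk (a b : R) (x y : M) :
    Idealization.mk a x + Idealization.mk b y = Idealization.mk (a + b) (x + y) := rfl

variable (R M)

/-- If `R` is local then so is `R ⋉ M`. -/
instance instIsLocalRingIdealization [IsLocalRing R] : IsLocalRing (Idealization R M) :=
  letI : Module Rᵐᵒᵖ M := Module.compHom M ((RingHom.id R).fromOpposite mul_comm)
  haveI : IsCentralScalar R M := ⟨fun _ _ => rfl⟩
  haveI : IsLocalHom (TrivSqZeroExt.fstHom R R M).toRingHom :=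
    ⟨fun _ h => TrivSqZeroExt.isUnit_iff_isUnit_fst.mpr h⟩
  show IsLocalRing (TrivSqZeroExt R M) from
    RingHom.domain_isLocalRing (TrivSqZeroExt.fstHom R R M).toRingHom

end Idealization

/-- The Krull dimension of `R` as a natural number (it is finite when `R` is a Noetherian local
ring, the only case of interest here). -/
def dim (R : Type u) [CommRing R] : ℕ := ((ringKrullDim R).unbotD 0).toNat

section Modules

variable (R : Type u) [CommRing R] [IsLocalRing R] (M : Type u) [AddCommGroup M] [Module R M]

/-- The depth of a nonzero finitely generated module over a Noetherian local ring: the supremum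
of the lengths of the `M`-regular sequences in the maximal ideal. -/
def depth : ℕ∞ :=
  ⨆ rs : {rs : List R // RingTheory.Sequence.IsRegular M rs ∧
    ∀ r ∈ rs, r ∈ IsLocalRing.maximalIdeal R}, (rs.1.length : ℕ∞)

/-- `M` is a maximal Cohen-Macaulay `R`-module: it is finitely generated and nonzero, and
`depth M = dim R`.  (The zero module is excluded, its depth being infinite by convention.) -/
structure IsMCM : Prop where
  finite : Module.Finite R M
  nontrivial : Nontrivial M
  depth_eq : (depth R M : WithBot ℕ∞) = ringKrullDim R

/-- The Cohen-Macaulay type `r_R(M)` of `M`: the length of `Ext^d_R(R/𝔪, M)`, where `d = dim R`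
and `𝔪` is the maximal ideal of `R`. -/
def cmType : ℕ∞ :=
  Module.length R
    (Abelian.Ext (ModuleCat.of R (R ⧸ IsLocalRing.maximalIdeal R)) (ModuleCat.of R M) (dim R))

/-- `M` is a canonical module of the Cohen-Macaulay local ring `R`: a maximal Cohen-Macaulay
module of type one and of finite injective dimension. -/
structure IsCanonicalModule : Prop where
  isMCM : IsMCM R M
  cmType_eq_one : cmType R M = 1
  finite_injectiveDimension : ∃ n : ℕ, HasInjectiveDimensionLE (ModuleCat.of R M) n

end Modules

/-- A Cohen-Macaulay local ring: a Noetherian local ring whose depth equals its dimension. -/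
class IsCMLocalRing (R : Type u) [CommRing R] : Prop extends
    IsNoetherianRing R, IsLocalRing R where
  depth_eq : (depth R R : WithBot ℕ∞) = ringKrullDim R

/-- A parameter ideal of a local ring `R` of dimension `d`: an ideal generated by `d` elements
whose radical is the maximal ideal. -/
def IsParameterIdeal (R : Type u) [CommRing R] [IsLocalRing R] (q : Ideal R) : Prop :=
  (∃ a : Fin (dim R) → R, q = Ideal.span (Set.range a)) ∧
    q.radical = IsLocalRing.maximalIdeal R

/-- `M` is residually faithful: `M / q M` is a faithful `R / q`-module for some parameter
ideal `q` of `R`. -/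
def IsResiduallyFaithful (R : Type u) [CommRing R] [IsLocalRing R]
    (M : Type u) [AddCommGroup M] [Module R M] : Prop :=
  ∃ q : Ideal R, IsParameterIdeal R q ∧
    FaithfulSMul (R ⧸ q) (M ⧸ (q • ⊤ : Submodule R M))

/-- The evaluation map `Hom_R(M, N) ⊗ M → N`, `f ⊗ x ↦ f x`. -/
def evalMap (R : Type u) [CommRing R] (M N : Type u) [AddCommGroup M] [Module R M]
    [AddCommGroup N] [Module R N] : (M →ₗ[R] N) ⊗[R] M →ₗ[R] N :=
  TensorProduct.lift LinearMap.id

theorem evalMap_tmul (R : Type u) [CommRing R] (M N : Type u) [AddCommGroup M] [Module R M]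
    [AddCommGroup N] [Module R N] (f : M →ₗ[R] N) (x : M) :
    evalMap R M N (f ⊗ₜ[R] x) = f x := rfl

end CMType

end

/-! Fix a system of parameters `rs` generating `q`, and let `d = dim R`, `k = R ⧸ 𝔪`. Conditions 1
and 2 are each shown to be equivalent to faithfulness of `M ⧸ qM` over `R ⧸ q`. Neither mentions
`q`, so it is immaterial for which parameter ideal faithfulness is known.

Type side. By Rees' lemma `Ext^d(k, L)` is the socle of `L ⧸ qL` as soon as `rs` is `L`-regular
(`cmType_eq_length`). For `A = R ⋉ M`, the socle of `A ⧸ qA` is an extension of its image in `R ⧸ q`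
by the socle of `M ⧸ qM` (`length_idealizationSocle`). That image is the socle of `R ⧸ q`
intersected with the annihilator of `M ⧸ qM`. Lengths are finite, so the types agree exactly when
the image is zero; and since a nonzero ideal of `R ⧸ q` contains a nonzero socle element, this means
that the annihilator is zero (`range_socleFst_eq_bot_iff`).

Evaluation side. Finite injective dimension of `K` forces `Ext^j(k, K) = 0` for `j > d`. Since
`Hom(-, K ⧸ qK)` is `Ext^d(-, K)` on modules killed by `q`, the module `K ⧸ qK` is injective
relative to finitely generated such modules (`exists_extension_of_isWeaklyRegular`). If `M ⧸ qM` is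
faithful, `R ⧸ q` embeds in a power of it, so every map `R ⧸ q → K ⧸ qK` extends to that power. Its
components lift to maps `M → K` because `Ext^i(M, K) = 0` for `i > 0`, and Nakayama gives
surjectivity. Conversely, if evaluation is surjective, whatever kills `M ⧸ qM` kills `K ⧸ qK`, which
is faithful by the same extension property. -/

noncomputable section

open CategoryTheory Abelian RingTheory.Sequence IsLocalRing Pointwise TensorProduct

namespace CMType

/-! ### Regular sequences and Ext: Rees' lemma -/

section Ext

variable {R : Type u} [CommRing R]

/-- The complex `0 → L → L → L ⧸ a L → 0` given by multiplication by `a`. -/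
abbrev mulComplex (L : ModuleCat.{u} R) (a : R) : ShortComplex (ModuleCat.{u} R) :=
  ShortComplex.mk (X₁ := L) (X₂ := L) (X₃ := ModuleCat.of R (QuotSMulTop a L)) (a • 𝟙 L)
    (ModuleCat.ofHom (a • (⊤ : Submodule R L)).mkQ) (L.smulShortComplex a).zero

lemma mulComplex_shortExact {L : ModuleCat.{u} R} {a : R} (ha : IsSMulRegular L a) :
    (mulComplex L a).ShortExact :=
  ha.smulShortComplex_shortExact

lemma comp_mk₀_smul_id {N L : ModuleCat.{u} R} (a : R) {i : ℕ} (x : Ext N L i) :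
    x.comp (Ext.mk₀ (a • 𝟙 L)) (add_zero i) = a • x :=
  (Ext.smul_eq_comp_mk₀ x a).symm

lemma mk₀_smul_id_comp {N L : ModuleCat.{u} R} (a : R) {i : ℕ} (x : Ext N L i) :
    (Ext.mk₀ (a • 𝟙 N)).comp x (zero_add i) = a • x := by
  rw [Ext.mk₀_smul, Ext.smul_comp, Ext.mk₀_id_comp]

lemma subsingleton_ext_quotSMulTop (N L : ModuleCat.{u} R) {a : R} (ha : IsSMulRegular L a)
    {i : ℕ} (h0 : Subsingleton (Ext N L i)) (h1 : Subsingleton (Ext N L (i + 1))) :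
    Subsingleton (Ext N (ModuleCat.of R (QuotSMulTop a L)) i) := by
  refine subsingleton_of_forall_eq 0 fun x => ?_
  obtain ⟨y, rfl⟩ := Ext.covariant_sequence_exact₃ N (mulComplex_shortExact ha) x rfl
    (Subsingleton.elim _ _)
  rw [Subsingleton.elim y 0, Ext.zero_comp]

lemma ext_smul_eq_zero {N L : ModuleCat.{u} R} {a : R} (ha : a ∈ Module.annihilator R N) {i : ℕ}
    (x : Ext N L i) : a • x = 0 := by
  rw [← mk₀_smul_id_comp]
  have : a • 𝟙 N = 0 := by
    ext y
    exact Module.mem_annihilator.mp ha y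
  rw [this, Ext.mk₀_zero, Ext.zero_comp]

/-- Ext vanishing below the length of a regular sequence killing the first argument. -/
lemma subsingleton_ext_of_isWeaklyRegular (N : ModuleCat.{u} R) (rs : List R) (L : ModuleCat.{u} R)
    (reg : IsWeaklyRegular L rs) (hN : ∀ r ∈ rs, r ∈ Module.annihilator R N) (i : ℕ)
    (hi : i < rs.length) : Subsingleton (Ext N L i) := by
  induction rs generalizing L i with
  | nil => simp at hi
  | cons a rs ih =>
    rw [isWeaklyRegular_cons_iff] at reg
    have haN := hN a List.mem_cons_self
    match i with
    | 0 =>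
      have := reg.1.linearMap_subsingleton_of_mem_annihilator haN
      exact (Ext.addEquiv₀.trans ModuleCat.homAddEquiv).subsingleton
    | i + 1 =>
      refine subsingleton_of_forall_eq 0 fun x => ?_
      obtain ⟨y, rfl⟩ := Ext.covariant_sequence_exact₁ N (mulComplex_shortExact reg.1) x
        (by rw [comp_mk₀_smul_id, ext_smul_eq_zero haN]) rfl
      have := ih (ModuleCat.of R (QuotSMulTop a L)) reg.2
        (fun r hr => hN r (List.mem_cons_of_mem _ hr)) i (by simpa using hi)
      rw [Subsingleton.elim y 0, Ext.zero_comp]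

/-- **Rees' lemma**, in a form natural in the first argument. -/
lemma exists_ext_comp_bijective (rs : List R) (L : ModuleCat.{u} R) (reg : IsWeaklyRegular L rs) :
    ∃ θ : Ext (ModuleCat.of R (L ⧸ (Ideal.ofList rs • ⊤ : Submodule R L))) L rs.length,
      ∀ N : ModuleCat.{u} R, (∀ r ∈ rs, r ∈ Module.annihilator R N) →
        Function.Bijective fun f : Ext N _ 0 => f.comp θ (zero_add _) := by
  induction rs generalizing L with
  | nil =>
    let e : (L ⧸ (Ideal.ofList ([] : List R) • ⊤ : Submodule R L)) ≃ₗ[R] L :=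
      Submodule.quotEquivOfEqBot _ (by rw [Ideal.ofList_nil, Submodule.bot_smul])
    refine ⟨Ext.mk₀ e.toModuleIso.hom, fun N _ => Function.bijective_iff_has_inverse.mpr
      ⟨fun g => g.comp (Ext.mk₀ e.toModuleIso.inv) (zero_add _), fun f => ?_, fun g => ?_⟩⟩
    · change (f.comp (Ext.mk₀ _) _).comp _ _ = f
      rw [Ext.comp_assoc _ _ _ _ (zero_add 0) _, Ext.mk₀_comp_mk₀, Iso.hom_inv_id,
        Ext.comp_mk₀_id]
      rfl
    · change (Ext.comp g _ _).comp (Ext.mk₀ _) _ = g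
      rw [Ext.comp_assoc _ _ _ _ (zero_add 0) _, Ext.mk₀_comp_mk₀, Iso.inv_hom_id,
        Ext.comp_mk₀_id]
      rfl
  | cons a rs ih =>
    rw [isWeaklyRegular_cons_iff] at reg
    obtain ⟨θ, hθ⟩ := ih (ModuleCat.of R (QuotSMulTop a L)) reg.2
    let e := (Submodule.quotOfListConsSMulTopEquivQuotSMulTopInner L a rs).toModuleIso
    have hS := (mulComplex_shortExact reg.1)
    -- The new class is the class for `L ⧸ aL` followed by the connecting class of `0 → L → L → L ⧸
    -- aL → 0`. A single class serves all `N`, so naturality in `N` is associativity of composition.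
    refine ⟨(Ext.mk₀ e.hom).comp (θ.comp hS.extClass rfl) (zero_add _), fun N hN => ?_⟩
    have haN := hN a List.mem_cons_self
    have hN' := fun r hr => hN r (List.mem_cons_of_mem _ hr)
    have h1 : Function.Bijective
        fun f : Ext N _ 0 => f.comp (Ext.mk₀ e.hom) (zero_add 0) := by
      refine Function.bijective_iff_has_inverse.mpr
        ⟨fun g => g.comp (Ext.mk₀ e.inv) (zero_add _), fun f => ?_, fun g => ?_⟩ <;> simp
    have h2 := hθ N hN'
    have h3 : Function.Bijective fun f : Ext N _ rs.length => f.comp hS.extClass rfl := by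
      constructor
      · refine (injective_iff_map_eq_zero (hS.extClass.postcomp N rfl)).mpr fun f hf => ?_
        obtain ⟨y, rfl⟩ := Ext.covariant_sequence_exact₃ N hS f rfl hf
        have := subsingleton_ext_of_isWeaklyRegular N (a :: rs) L
          ((isWeaklyRegular_cons_iff _ _ _).mpr reg) hN rs.length (by simp)
        rw [Subsingleton.elim y 0, Ext.zero_comp]
      · intro x
        exact Ext.covariant_sequence_exact₁ N hS x
          (by rw [comp_mk₀_smul_id, ext_smul_eq_zero haN]) rfl
    have h4 : (fun f : Ext N _ 0 => f.comp
        ((Ext.mk₀ e.hom).comp (θ.comp hS.extClass rfl) (zero_add _)) (zero_add _)) =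
        ((fun f : Ext N _ rs.length => f.comp hS.extClass rfl) ∘ (fun f => f.comp θ (zero_add _))) ∘
          (fun f : Ext N _ 0 => f.comp (Ext.mk₀ e.hom) (zero_add 0)) := by
      funext f
      simp only [Function.comp_apply]
      rw [Ext.comp_assoc f (Ext.mk₀ e.hom) θ (zero_add 0) (zero_add _) (by simp),
        Ext.comp_assoc f ((Ext.mk₀ e.hom).comp θ (zero_add _)) hS.extClass (zero_add _) rfl
          (by simp),
        Ext.comp_assoc (Ext.mk₀ e.hom) θ hS.extClass (zero_add _) rfl (by simp)]
    exact h4 ▸ (h3.comp h2).comp h1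

end Ext

/-! ### Dévissage, Ischebeck-type vanishing, and systems of parameters as regular sequences -/

section Devissage

variable {R : Type u} [CommRing R]

lemma subsingleton_ext_congr {N N' : Type u} [AddCommGroup N] [Module R N] [AddCommGroup N']
    [Module R N'] (e : N ≃ₗ[R] N') (Y : ModuleCat.{u} R) (i : ℕ)
    (h : Subsingleton (Ext (ModuleCat.of R N') Y i)) :
    Subsingleton (Ext (ModuleCat.of R N) Y i) := by
  refine subsingleton_of_forall_eq 0 fun x => ?_
  have hx : (Ext.mk₀ e.toModuleIso.inv).comp x (zero_add i) = 0 := Subsingleton.elim _ _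
  calc x = (Ext.mk₀ e.toModuleIso.hom).comp
        ((Ext.mk₀ e.toModuleIso.inv).comp x (zero_add i)) (zero_add i) := by
        rw [← Ext.comp_assoc _ _ _ (zero_add 0) _ (by simp), Ext.mk₀_comp_mk₀, Iso.hom_inv_id,
          Ext.mk₀_id_comp]
    _ = 0 := by rw [hx, Ext.comp_zero]

/-- The complex `N₁ → N₂ → N₃` of linear maps. -/
abbrev linearComplex {N₁ N₂ N₃ : Type u} [AddCommGroup N₁] [Module R N₁] [AddCommGroup N₂]
    [Module R N₂] [AddCommGroup N₃] [Module R N₃] {f : N₁ →ₗ[R] N₂} {g : N₂ →ₗ[R] N₃}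
    (h : Function.Exact f g) : ShortComplex (ModuleCat.{u} R) :=
  ShortComplex.mk (ModuleCat.ofHom f) (ModuleCat.ofHom g) (by
    ext x; exact h.apply_apply_eq_zero x)

lemma linearComplex_shortExact {N₁ N₂ N₃ : Type u} [AddCommGroup N₁] [Module R N₁]
    [AddCommGroup N₂] [Module R N₂] [AddCommGroup N₃] [Module R N₃] {f : N₁ →ₗ[R] N₂}
    {g : N₂ →ₗ[R] N₃} (h : Function.Exact f g) (hf : Function.Injective f)
    (hg : Function.Surjective g) : (linearComplex h).ShortExact :=
  ModuleCat.shortComplex_shortExact _ h hf hg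

/-- Dévissage: vanishing of `Ext^i(-, Y)` on `R ⧸ p` for the primes `p` containing the annihilator
of `N` gives vanishing on `N`. -/
lemma subsingleton_ext_of_primes [IsNoetherianRing R] (Y : ModuleCat.{u} R) (i : ℕ) (N : Type u)
    [AddCommGroup N] [Module R N] [hN : Module.Finite R N]
    (h : ∀ p : Ideal R, p.IsPrime → Module.annihilator R N ≤ p →
      Subsingleton (Ext (ModuleCat.of R (R ⧸ p)) Y i)) :
    Subsingleton (Ext (ModuleCat.of R N) Y i) := by
  revert h
  induction hN using IsNoetherianRing.induction_on_isQuotientEquivQuotientPrime R with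
  | subsingleton N =>
    intro _
    refine subsingleton_of_forall_eq 0 fun x => ?_
    have : 𝟙 (ModuleCat.of R N) = 0 := by
      ext y
      exact Subsingleton.elim (α := N) _ _
    rw [← Ext.mk₀_id_comp x, this, Ext.mk₀_zero, Ext.zero_comp]
  | quotient N p f =>
    intro h
    refine subsingleton_ext_congr f Y i (h p.1 p.2 ?_)
    rw [f.annihilator_eq, Ideal.annihilator_quotient]
  | exact N₁ N₂ N₃ f g hf hg hfg h₁ h₃ =>
    intro h
    have h1 := h₁ fun p hp hle => h p hp ((f.annihilator_le_of_injective hf).trans hle)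
    have h3 := h₃ fun p hp hle => h p hp ((g.annihilator_le_of_surjective hg).trans hle)
    refine subsingleton_of_forall_eq 0 fun x => ?_
    obtain ⟨y, rfl⟩ := Ext.contravariant_sequence_exact₂ (linearComplex_shortExact hfg hf hg) Y x
      (Subsingleton.elim _ _)
    rw [Subsingleton.elim y 0, Ext.comp_zero]

instance finite_quotSMulTop (a : R) (N : Type u) [AddCommGroup N] [Module R N]
    [Module.Finite R N] : Module.Finite R (QuotSMulTop a N) :=
  inferInstanceAs (Module.Finite R (N ⧸ (a • (⊤ : Submodule R N))))

lemma mem_annihilator_quotSMulTop (a : R) (N : Type u) [AddCommGroup N] [Module R N] :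
    a ∈ Module.annihilator R (QuotSMulTop a N) := by
  rw [Module.mem_annihilator]
  intro x
  obtain ⟨y, rfl⟩ := Submodule.mkQ_surjective _ x
  rw [← map_smul, Submodule.mkQ_apply, Submodule.Quotient.mk_eq_zero]
  exact Submodule.smul_mem_pointwise_smul _ _ _ trivial

lemma annihilator_le_quotSMulTop (a : R) (N : Type u) [AddCommGroup N] [Module R N] :
    Module.annihilator R N ≤ Module.annihilator R (QuotSMulTop a N) :=
  LinearMap.annihilator_le_of_surjective (Submodule.mkQ _) (Submodule.mkQ_surjective _)

/-- Passing from `N` to `N ⧸ aN` moves `a` from the list into the annihilator. This keeps the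
hypothesis that `(rs) + ann N` contains a power of `𝔪` stable in the inductions on `rs`. -/
lemma ofList_cons_sup_annihilator_le (a : R) (rs : List R) (N : Type u) [AddCommGroup N]
    [Module R N] : Ideal.ofList (a :: rs) ⊔ Module.annihilator R N ≤
      Ideal.ofList rs ⊔ Module.annihilator R (QuotSMulTop a N) := by
  rw [Ideal.ofList_cons]
  refine sup_le (sup_le ?_ le_sup_left) ((annihilator_le_quotSMulTop a N).trans le_sup_right)
  rw [Ideal.span_singleton_le_iff_mem]
  exact Ideal.mem_sup_right (mem_annihilator_quotSMulTop a N)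

variable [IsLocalRing R]

lemma eq_maximalIdeal_of_le_radical {p I : Ideal R} (hp : p.IsPrime)
    (hI : maximalIdeal R ≤ I.radical) (h : I ≤ p) : p = maximalIdeal R :=
  le_antisymm (le_maximalIdeal hp.ne_top) (hI.trans (hp.radical_le_iff.mpr h))

variable [IsNoetherianRing R]

lemma subsingleton_ext_of_maximalIdeal_le_radical (Y : ModuleCat.{u} R) (i : ℕ)
    (h : Subsingleton (Ext (ModuleCat.of R (R ⧸ maximalIdeal R)) Y i)) (N : Type u)
    [AddCommGroup N] [Module R N] [Module.Finite R N]
    (hN : maximalIdeal R ≤ (Module.annihilator R N).radical) :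
    Subsingleton (Ext (ModuleCat.of R N) Y i) := by
  refine subsingleton_ext_of_primes Y i N fun p hp hle => ?_
  rwa [eq_maximalIdeal_of_le_radical hp hN hle]

/-- Nakayama for the multiplication by a regular element on `Ext`. -/
lemma subsingleton_ext_of_quotSMulTop (N Y : ModuleCat.{u} R) [Module.Finite R N]
    [Module.Finite R Y] {a : R} (ha : a ∈ maximalIdeal R) (reg : IsSMulRegular N a) (i : ℕ)
    (h : Subsingleton (Ext (ModuleCat.of R (QuotSMulTop a N)) Y (i + 1))) :
    Subsingleton (Ext N Y i) := by
  have key : (⊤ : Submodule R (Ext N Y i)) ≤ maximalIdeal R • ⊤ := by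
    intro x _
    obtain ⟨y, rfl⟩ := Ext.contravariant_sequence_exact₁ (mulComplex_shortExact reg) Y x
      (add_comm 1 i) (Subsingleton.elim _ _)
    rw [mk₀_smul_id_comp]
    exact Submodule.smul_mem_smul ha trivial
  have := Submodule.eq_bot_of_le_smul_of_le_jacobson_bot _ _ Module.Finite.fg_top key
    (maximalIdeal_le_jacobson _)
  exact (Submodule.subsingleton_iff R).mp (subsingleton_of_bot_eq_top this.symm)

/-- A version of Ischebeck's theorem: if `N ⧸ rs N` has finite length, then `Ext^i(N, Y)` vanishes
for `i + length rs` less than the depth of `Y`. -/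
lemma subsingleton_ext_of_add_length_lt (Y : ModuleCat.{u} R) [Module.Finite R Y] (n : ℕ)
    (hY : ∀ i < n, Subsingleton (Ext (ModuleCat.of R (R ⧸ maximalIdeal R)) Y i))
    (rs : List R) (hrs : ∀ r ∈ rs, r ∈ maximalIdeal R) (N : Type u)
    [AddCommGroup N] [Module R N] [Module.Finite R N]
    (hN : maximalIdeal R ≤ (Ideal.ofList rs ⊔ Module.annihilator R N).radical)
    (i : ℕ) (hi : i + rs.length < n) : Subsingleton (Ext (ModuleCat.of R N) Y i) := by
  induction rs generalizing N i with
  | nil =>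
    exact subsingleton_ext_of_maximalIdeal_le_radical Y i (hY i hi) N (by simpa using hN)
  | cons a rs ih =>
    rw [List.length_cons] at hi
    have ih := ih fun r hr => hrs r (List.mem_cons_of_mem _ hr)
    refine subsingleton_ext_of_primes Y i N fun p hp hle => ?_
    have hp' : maximalIdeal R ≤ (Ideal.ofList (a :: rs) ⊔ p).radical :=
      hN.trans (Ideal.radical_mono (sup_le_sup_left hle _))
    -- If `a ∈ p`, then `a` is redundant and the list gets shorter. Otherwise `a` is regular on the
    -- domain `R ⧸ p`, and Nakayama trades `a` for one more degree, which leaves `i + length`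
    -- unchanged.
    by_cases hap : a ∈ p
    · refine ih (R ⧸ p) ?_ i (by omega)
      rw [Ideal.annihilator_quotient]
      refine hp'.trans (Ideal.radical_mono (sup_le ?_ le_sup_right))
      rw [Ideal.ofList_cons]
      exact sup_le ((Ideal.span_singleton_le_iff_mem _).mpr (Ideal.mem_sup_right hap)) le_sup_left
    · have reg : IsSMulRegular (R ⧸ p) a := by
        rw [isSMulRegular_iff_right_eq_zero_of_smul]
        intro x hx
        obtain ⟨x, rfl⟩ := Ideal.Quotient.mk_surjective x
        rw [← Ideal.Quotient.mk_eq_mk, ← Submodule.Quotient.mk_smul, Ideal.Quotient.mk_eq_mk,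
          Ideal.Quotient.eq_zero_iff_mem] at hx
        exact Ideal.Quotient.eq_zero_iff_mem.mpr ((hp.mem_or_mem hx).resolve_left hap)
      refine subsingleton_ext_of_quotSMulTop (ModuleCat.of R (R ⧸ p)) Y (hrs a List.mem_cons_self)
        reg i (ih (QuotSMulTop a (R ⧸ p)) ?_ (i + 1) (by omega))
      refine hp'.trans (Ideal.radical_mono ?_)
      have := ofList_cons_sup_annihilator_le a rs (R ⧸ p)
      rwa [Ideal.annihilator_quotient] at this

/-- A system of parameters is a regular sequence on a module of maximal depth. -/
lemma isWeaklyRegular_of_subsingleton_ext (rs : List R) (hrs : ∀ r ∈ rs, r ∈ maximalIdeal R)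
    (M : Type u) [AddCommGroup M] [Module R M] [Module.Finite R M]
    (hM : ∀ i < rs.length,
      Subsingleton (Ext (ModuleCat.of R (R ⧸ maximalIdeal R)) (ModuleCat.of R M) i))
    (hN : maximalIdeal R ≤ (Ideal.ofList rs ⊔ Module.annihilator R M).radical) :
    IsWeaklyRegular M rs := by
  induction rs generalizing M with
  | nil => exact .nil R M
  | cons a rs ih =>
    have hrs' : ∀ r ∈ rs, r ∈ maximalIdeal R := fun r hr => hrs r (List.mem_cons_of_mem _ hr)
    have ha : IsSMulRegular M a := by
      -- The `a`-torsion is killed by `a`, so the shorter list `rs` already cuts it down to finite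
      -- length. Its length is below the depth bound, hence `Hom(T, M) = 0`, and the inclusion of
      -- `T` vanishes.
      let T := Submodule.torsionBy R M a
      have hT : Subsingleton (Ext (ModuleCat.of R T) (ModuleCat.of R M) 0) := by
        refine subsingleton_ext_of_add_length_lt (ModuleCat.of R M) (rs.length + 1)
          (by simpa using hM) rs hrs' T (hN.trans (Ideal.radical_mono ?_)) 0 (by simp)
        rw [Ideal.ofList_cons]
        refine sup_le (sup_le ?_ le_sup_left)
          ((LinearMap.annihilator_le_of_injective T.subtype T.injective_subtype).trans le_sup_right)
        rw [Ideal.span_singleton_le_iff_mem]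
        refine Ideal.mem_sup_right (Module.mem_annihilator.mpr fun x => ?_)
        exact Subtype.ext x.2
      have hT' : Subsingleton (T →ₗ[R] M) :=
        ((Ext.addEquiv₀ (X := ModuleCat.of R T) (Y := ModuleCat.of R M)).trans
          ModuleCat.homAddEquiv).symm.subsingleton
      rw [isSMulRegular_iff_right_eq_zero_of_smul]
      intro x hx
      exact LinearMap.congr_fun (Subsingleton.elim T.subtype 0) ⟨x, hx⟩
    refine .cons ha (ih hrs' (QuotSMulTop a M) (fun i hi => ?_)
      (hN.trans (Ideal.radical_mono (ofList_cons_sup_annihilator_le a rs M))))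
    exact subsingleton_ext_quotSMulTop _ (ModuleCat.of R M) ha
      (hM i (by rw [List.length_cons]; omega)) (hM (i + 1) (by rw [List.length_cons]; omega))

end Devissage

/-! ### Lifting and extending homomorphisms; Ext into modules of finite injective dimension -/

section InjectiveDimension

variable {R : Type u} [CommRing R]

/-- If the higher `Ext(M, L)` vanish, homomorphisms to `L ⧸ rs L` lift to `L`. -/
lemma exists_lift_of_isWeaklyRegular (M : Type u) [AddCommGroup M] [Module R M] (rs : List R)
    (L : Type u) [AddCommGroup L] [Module R L] (reg : IsWeaklyRegular L rs)
    (h : ∀ i, 0 < i → Subsingleton (Ext (ModuleCat.of R M) (ModuleCat.of R L) i))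
    (g : M →ₗ[R] L ⧸ (Ideal.ofList rs • ⊤ : Submodule R L)) :
    ∃ f : M →ₗ[R] L, Submodule.mkQ _ ∘ₗ f = g := by
  induction rs generalizing L with
  | nil =>
    let e : (L ⧸ (Ideal.ofList ([] : List R) • ⊤ : Submodule R L)) ≃ₗ[R] L :=
      Submodule.quotEquivOfEqBot _ (by rw [Ideal.ofList_nil, Submodule.bot_smul])
    refine ⟨e.toLinearMap ∘ₗ g, LinearMap.ext fun x => ?_⟩
    exact e.symm_apply_apply (g x)
  | cons a rs ih =>
    rw [isWeaklyRegular_cons_iff] at reg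
    let e := Submodule.quotOfListConsSMulTopEquivQuotSMulTopInner L a rs
    obtain ⟨f', hf'⟩ := ih (QuotSMulTop a L) reg.2
      (fun i hi => subsingleton_ext_quotSMulTop _ (ModuleCat.of R L) reg.1 (h i hi)
        (h (i + 1) (by omega))) (e.toLinearMap ∘ₗ g)
    -- The obstruction to lifting along `L → L ⧸ aL` lies in `Ext^1(M, L)`.
    have := h 1 one_pos
    obtain ⟨y, hy⟩ := Ext.covariant_sequence_exact₃ (ModuleCat.of R M)
      (mulComplex_shortExact (L := ModuleCat.of R L) reg.1) (Ext.mk₀ (ModuleCat.ofHom f')) (n₁ := 1)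
      rfl (Subsingleton.elim _ _)
    obtain ⟨f, rfl⟩ := (Ext.mk₀_bijective _ _).2 y
    rw [Ext.mk₀_comp_mk₀] at hy
    have hf := (Ext.mk₀_bijective _ _).1 hy
    refine ⟨f.hom, LinearMap.ext fun x => e.injective ?_⟩
    have h1 : Submodule.mkQ _ (f.hom x) = f' x := ConcreteCategory.congr_hom hf x
    have h2 := LinearMap.congr_fun hf' x
    rw [LinearMap.comp_apply, ← h1] at h2
    exact h2

/-- If `Ext^{d+1}(-, K)` vanishes on the cokernels at hand, where `d = length rs`, then `K ⧸ rs K`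
is injective relative to modules killed by `rs`. -/
lemma exists_extension_of_isWeaklyRegular {K : Type u} [AddCommGroup K] [Module R K] (rs : List R)
    (reg : IsWeaklyRegular K rs) {N L : Type u} [AddCommGroup N] [Module R N] [AddCommGroup L]
    [Module R L] (j : N →ₗ[R] L) (hj : Function.Injective j)
    (hL : ∀ r ∈ rs, r ∈ Module.annihilator R L)
    (hext : Subsingleton
      (Ext (ModuleCat.of R (L ⧸ LinearMap.range j)) (ModuleCat.of R K) (rs.length + 1)))
    (φ : N →ₗ[R] K ⧸ (Ideal.ofList rs • ⊤ : Submodule R K)) :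
    ∃ ψ : L →ₗ[R] K ⧸ (Ideal.ofList rs • ⊤ : Submodule R K), ψ ∘ₗ j = φ := by
  -- Composition with `θ` turns the extension problem into surjectivity of `Ext^d(L, K) → Ext^d(N,
  -- K)`, whose obstruction lies in `Ext^{d+1}` of the cokernel.
  obtain ⟨θ, hθ⟩ := exists_ext_comp_bijective rs (ModuleCat.of R K) reg
  have hN : ∀ r ∈ rs, r ∈ Module.annihilator R N := fun r hr =>
    j.annihilator_le_of_injective hj (hL r hr)
  rw [add_comm] at hext
  obtain ⟨y, hy⟩ := Ext.contravariant_sequence_exact₁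
    (linearComplex_shortExact j.exact_map_mkQ_range hj (Submodule.mkQ_surjective _))
    (ModuleCat.of R K) ((Ext.mk₀ (ModuleCat.ofHom φ)).comp θ (zero_add _)) (n₁ := 1 + rs.length) rfl
    (Subsingleton.elim _ _)
  obtain ⟨z, rfl⟩ := (hθ (ModuleCat.of R L) hL).2 y
  obtain ⟨ψ, rfl⟩ := (Ext.mk₀_bijective _ _).2 z
  refine ⟨ψ.hom, ?_⟩
  have h1 : (Ext.mk₀ (ModuleCat.ofHom j ≫ ψ)).comp θ (zero_add _) =
      (Ext.mk₀ (ModuleCat.ofHom φ)).comp θ (zero_add _) := by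
    rw [← hy, ← Ext.mk₀_comp_mk₀, Ext.comp_assoc _ _ _ (zero_add 0) (zero_add _) (by simp)]
  have h2 := (Ext.mk₀_bijective _ _).1 ((hθ (ModuleCat.of R N) hN).1 h1)
  exact LinearMap.ext fun x => ConcreteCategory.congr_hom h2 x

variable [IsLocalRing R] [IsNoetherianRing R]

lemma exists_injective_residue (N : Type u) [AddCommGroup N] [Module R N] [Nontrivial N]
    (hN : maximalIdeal R ≤ (Module.annihilator R N).radical) :
    ∃ f : (R ⧸ maximalIdeal R) →ₗ[R] N, Function.Injective f := by
  obtain ⟨p, hp⟩ := associatedPrimes.nonempty R N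
  obtain ⟨hprime, f, hf⟩ :=
    (isAssociatedPrime_iff_exists_injective_linearMap _ _).mp hp
  have hle : Module.annihilator R N ≤ p :=
    (Submodule.annihilator_top (R := R) (M := N)).symm.le.trans hp.annihilator_le
  obtain rfl := eq_maximalIdeal_of_le_radical hprime hN hle
  exact ⟨f, hf⟩

/-- A module of finite injective dimension has no `Ext` from finite length modules above `d`. -/
lemma subsingleton_ext_of_hasInjectiveDimensionLE (K : ModuleCat.{u} R) (n : ℕ)
    [HasInjectiveDimensionLE K n] (rs : List R) (reg : IsRegular R rs)
    (hrad : maximalIdeal R ≤ (Ideal.ofList rs).radical) (j : ℕ) (hj : rs.length < j)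
    (N : Type u) [AddCommGroup N] [Module R N] [Module.Finite R N]
    (hN : maximalIdeal R ≤ (Module.annihilator R N).radical) :
    Subsingleton (Ext (ModuleCat.of R N) K j) := by
  -- Descending induction on `j`, with `t` measuring how far `j` is below `n + 1`. Embed `k` in `R ⧸
  -- (rs)` with cokernel `C`: then `Ext^j(k, K)` sits between `Ext^j(R ⧸ (rs), K)`, zero since the
  -- projective dimension is `length rs < j`, and `Ext^{j+1}(C, K)`, zero by induction.
  obtain ⟨t, ht⟩ : ∃ t, n + 1 ≤ j + t := ⟨n + 1, by omega⟩
  induction t generalizing j N with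
  | zero => exact HasInjectiveDimensionLT.subsingleton K (n + 1) j ht _
  | succ t ih =>
    refine subsingleton_ext_of_maximalIdeal_le_radical K j ?_ N hN
    have hann : Module.annihilator R (R ⧸ Ideal.ofList rs) = Ideal.ofList rs :=
      Ideal.annihilator_quotient
    have hnt : Nontrivial (R ⧸ Ideal.ofList rs) :=
      Ideal.Quotient.nontrivial_iff.mpr fun h => reg.top_ne_smul (by simp [h])
    obtain ⟨f, hf⟩ := exists_injective_residue (R ⧸ Ideal.ofList rs) (by rwa [hann])
    have hC := ih (1 + j) (by omega) ((R ⧸ Ideal.ofList rs) ⧸ LinearMap.range f)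
      (hrad.trans (Ideal.radical_mono (hann.symm.le.trans
        (LinearMap.annihilator_le_of_surjective _ (Submodule.mkQ_surjective _))))) (by omega)
    have hQ : Subsingleton (Ext (ModuleCat.of R (R ⧸ Ideal.ofList rs)) K j) := by
      refine subsingleton_ext_congr (Shrink.linearEquiv R (R ⧸ Ideal.ofList rs)).symm K j ?_
      have : HasProjectiveDimensionLE
          (ModuleCat.of R (Shrink.{u} (R ⧸ Ideal.ofList rs))) rs.length := by
        rw [← projectiveDimension_le_iff, ModuleCat.projectiveDimension_quotient_eq_length rs reg]
      exact HasProjectiveDimensionLT.subsingleton _ (rs.length + 1) j hj _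
    refine subsingleton_of_forall_eq 0 fun x => ?_
    obtain ⟨y, rfl⟩ := Ext.contravariant_sequence_exact₁
      (linearComplex_shortExact f.exact_map_mkQ_range hf (Submodule.mkQ_surjective _)) K x
      (n₁ := 1 + j) rfl (Subsingleton.elim _ _)
    rw [Subsingleton.elim y 0, Ext.comp_zero]

/-- By Nakayama, vanishing of `Ext^{i+1}(N ⧸ aN, K)` gives that of `Ext^i(N, K)`. Each regular
element thus lowers by one the degree from which Ext vanishes. -/
lemma subsingleton_ext_of_lt_add_length (K : ModuleCat.{u} R) [Module.Finite R K] (d : ℕ)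
    (hK : ∀ j, d < j → Subsingleton (Ext (ModuleCat.of R (R ⧸ maximalIdeal R)) K j))
    (rs : List R) (hrs : ∀ r ∈ rs, r ∈ maximalIdeal R) (N : Type u) [AddCommGroup N] [Module R N]
    [Module.Finite R N] (reg : IsWeaklyRegular N rs)
    (hN : maximalIdeal R ≤ (Ideal.ofList rs ⊔ Module.annihilator R N).radical)
    (i : ℕ) (hi : d < i + rs.length) : Subsingleton (Ext (ModuleCat.of R N) K i) := by
  induction rs generalizing N i with
  | nil =>
    exact subsingleton_ext_of_maximalIdeal_le_radical K i (hK i hi) N (by simpa using hN)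
  | cons a rs ih =>
    rw [isWeaklyRegular_cons_iff] at reg
    rw [List.length_cons] at hi
    exact subsingleton_ext_of_quotSMulTop (ModuleCat.of R N) K (hrs a List.mem_cons_self)
      reg.1 i (ih (fun r hr => hrs r (List.mem_cons_of_mem _ hr)) (QuotSMulTop a N) reg.2
        (hN.trans (Ideal.radical_mono (ofList_cons_sup_annihilator_le a rs N))) (i + 1) (by omega))

end InjectiveDimension

/-! ### Maximal Cohen-Macaulay modules and parameters -/

section MaximalCohenMacaulay

lemma coe_dim (R : Type u) [CommRing R] [IsLocalRing R] [IsNoetherianRing R] :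
    ((dim R : ℕ) : WithBot ℕ∞) = ringKrullDim R := by
  obtain ⟨n, hn⟩ : ∃ n : ℕ, ringKrullDim R = n := by
    have h1 : ringKrullDim R ≠ ⊥ := ringKrullDim_ne_bot
    have h2 : ringKrullDim R ≠ ⊤ := ringKrullDim_ne_top
    generalize ringKrullDim R = x at h1 h2
    induction x using WithBot.recBotCoe with
    | bot => exact absurd rfl h1
    | coe x =>
      induction x using ENat.recTopCoe with
      | top => exact absurd rfl h2
      | coe n => exact ⟨n, rfl⟩
  rw [dim, hn]
  rfl

lemma faithfulSMul_quotient_iff {R : Type u} [CommRing R] (q : Ideal R) (M : Type u) [AddCommGroup M] [Module R M] :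
    FaithfulSMul (R ⧸ q) (M ⧸ (q • ⊤ : Submodule R M)) ↔
      ∀ r : R, (∀ x : M, r • x ∈ (q • ⊤ : Submodule R M)) → r ∈ q := by
  rw [← Module.annihilator_eq_bot, eq_bot_iff]
  constructor
  · intro h r hr
    have : Ideal.Quotient.mk q r ∈ Module.annihilator (R ⧸ q) (M ⧸ (q • ⊤ : Submodule R M)) := by
      rw [Module.mem_annihilator]
      intro x
      obtain ⟨x, rfl⟩ := Submodule.Quotient.mk_surjective _ x
      exact (Submodule.Quotient.mk_eq_zero _).mpr (hr x)
    exact Ideal.Quotient.eq_zero_iff_mem.mp (h this)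
  · intro h r hr
    obtain ⟨r, rfl⟩ := Ideal.Quotient.mk_surjective r
    refine Ideal.Quotient.eq_zero_iff_mem.mpr (h r fun x => ?_)
    exact (Submodule.Quotient.mk_eq_zero _).mp
      (Module.mem_annihilator.mp hr (Submodule.Quotient.mk x))

variable {R : Type u} [CommRing R] [IsLocalRing R]

lemma IsMCM.exists_isRegular [IsNoetherianRing R] {M : Type u} [AddCommGroup M] [Module R M]
    (hM : IsMCM R M) :
    ∃ rs : List R, rs.length = dim R ∧ IsRegular M rs ∧ ∀ r ∈ rs, r ∈ maximalIdeal R := by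
  have h : depth R M = (dim R : ℕ∞) := by
    have := hM.depth_eq
    rw [← coe_dim] at this
    exact_mod_cast this
  have hnt := hM.nontrivial
  have hne : Nonempty {rs : List R // IsRegular M rs ∧ ∀ r ∈ rs, r ∈ maximalIdeal R} :=
    ⟨[], .nil R M, by simp⟩
  obtain ⟨⟨rs, hrs, hm⟩, hlen⟩ := ENat.exists_eq_iSup_of_lt_top
    (f := fun rs : {rs : List R // IsRegular M rs ∧ ∀ r ∈ rs, r ∈ maximalIdeal R} =>
      (rs.1.length : ℕ∞)) (by
      change depth R M < ⊤
      rw [h]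
      exact ENat.natCast_lt_top _)
  refine ⟨rs, ?_, hrs, hm⟩
  change (rs.length : ℕ∞) = depth R M at hlen
  rw [h] at hlen
  exact_mod_cast hlen

lemma IsMCM.subsingleton_ext [IsNoetherianRing R] {M : Type u} [AddCommGroup M] [Module R M]
    (hM : IsMCM R M) (i : ℕ) (hi : i < dim R) :
    Subsingleton (Ext (ModuleCat.of R (R ⧸ maximalIdeal R)) (ModuleCat.of R M) i) := by
  obtain ⟨rs, hlen, hrs, hm⟩ := hM.exists_isRegular
  refine subsingleton_ext_of_isWeaklyRegular _ rs (ModuleCat.of R M) hrs.toIsWeaklyRegular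
    (fun r hr => ?_) i (hlen ▸ hi)
  change r ∈ Module.annihilator R (R ⧸ maximalIdeal R)
  rw [Ideal.annihilator_quotient]
  exact hm r hr

lemma IsMCM.isWeaklyRegular [IsNoetherianRing R] {M : Type u} [AddCommGroup M] [Module R M]
    (hM : IsMCM R M) (rs : List R) (hlen : rs.length = dim R)
    (hrad : (Ideal.ofList rs).radical = maximalIdeal R) : IsWeaklyRegular M rs := by
  have := hM.finite
  refine isWeaklyRegular_of_subsingleton_ext rs (fun r hr => ?_) M
    (fun i hi => hM.subsingleton_ext i (hlen ▸ hi))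
    (hrad.symm.le.trans (Ideal.radical_mono le_sup_left))
  rw [← hrad]
  exact Ideal.le_radical (Ideal.subset_span hr)

lemma isParameterIdeal_iff_ofList (q : Ideal R) : IsParameterIdeal R q ↔
    ∃ rs : List R, rs.length = dim R ∧ q = Ideal.ofList rs ∧
      (Ideal.ofList rs).radical = maximalIdeal R := by
  constructor
  · rintro ⟨⟨a, rfl⟩, hrad⟩
    have h : Ideal.ofList (List.ofFn a) = Ideal.span (Set.range a) := by
      rw [Ideal.ofList]
      congr 1
      ext x
      simp [List.mem_ofFn]
    exact ⟨List.ofFn a, by simp, h.symm, h ▸ hrad⟩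
  · rintro ⟨rs, hlen, rfl, hrad⟩
    refine ⟨⟨fun i => rs.get (i.cast hlen.symm), ?_⟩, hrad⟩
    rw [Ideal.ofList]
    congr 1
    ext x
    simp only [Set.mem_ofPred_eq, Set.mem_range]
    rw [List.mem_iff_get]
    exact ⟨fun ⟨n, hn⟩ => ⟨n.cast hlen, hn⟩, fun ⟨n, hn⟩ => ⟨n.cast hlen.symm, hn⟩⟩

lemma radical_eq_maximalIdeal_of_ringKrullDim_eq_zero {I : Ideal R} (hI : I ≠ ⊤)
    (h : ringKrullDim (R ⧸ I) = 0) : I.radical = maximalIdeal R := by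
  have : Ring.KrullDimLE 0 (R ⧸ I) := Ring.krullDimLE_iff.mpr h.le
  refine le_antisymm ((maximalIdeal.isMaximal R).isPrime.radical_le_iff.mpr (le_maximalIdeal hI)) ?_
  rw [Ideal.radical_eq_sInf]
  refine le_sInf fun p hp => ?_
  have hp' := hp.2
  have hker : RingHom.ker (Ideal.Quotient.mk I) ≤ p := by simpa using hp.1
  have h1 : (p.map (Ideal.Quotient.mk I)).IsPrime :=
    Ideal.map_isPrime_of_surjective Ideal.Quotient.mk_surjective hker
  have h2 := h1.isMaximal'
  have h3 := Ideal.comap_isMaximal_of_surjective (Ideal.Quotient.mk I)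
    Ideal.Quotient.mk_surjective (K := p.map (Ideal.Quotient.mk I))
  rw [Ideal.comap_map_of_surjective' _ Ideal.Quotient.mk_surjective, sup_eq_left.mpr hker] at h3
  exact (eq_maximalIdeal h3).symm.le

/-- A regular sequence of length `dim R` lowers the dimension to zero, so the ideal it generates is
`𝔪`-primary. -/
lemma IsMCM.exists_parameters [IsNoetherianRing R] (hR : IsMCM R R) :
    ∃ rs : List R, rs.length = dim R ∧ (Ideal.ofList rs).radical = maximalIdeal R := by
  obtain ⟨rs, hlen, hrs, hm⟩ := hR.exists_isRegular
  refine ⟨rs, hlen, radical_eq_maximalIdeal_of_ringKrullDim_eq_zero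
    (fun h => hrs.top_ne_smul (by simp [h])) ?_⟩
  have h := ringKrullDim_add_length_eq_ringKrullDim_of_isRegular rs hrs
  rw [hlen, ← coe_dim R] at h
  refine le_antisymm ?_ ?_ <;>
    rw [← ENat.WithBot.add_le_add_natCast_right_iff (c := dim R), h, zero_add]

end MaximalCohenMacaulay

/-! ### Surjectivity of evaluation versus faithfulness modulo parameters -/

section Evaluation

lemma mem_annihilator_of_mem_ofList {R : Type u} [CommRing R] (rs : List R) (N : Type u)
    [AddCommGroup N] [Module R N] :
    ∀ r ∈ rs, r ∈ Module.annihilator R (N ⧸ (Ideal.ofList rs • ⊤ : Submodule R N)) := by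
  intro r hr
  rw [Module.mem_annihilator]
  intro x
  obtain ⟨x, rfl⟩ := Submodule.Quotient.mk_surjective _ x
  exact (Submodule.Quotient.mk_eq_zero _).mpr
    (Submodule.smul_mem_smul (Ideal.subset_span hr) trivial)

variable {R : Type u} [CommRing R] [IsLocalRing R] [IsNoetherianRing R]

lemma IsMCM.subsingleton_ext_of_pos {M K : Type u} [AddCommGroup M] [Module R M]
    [AddCommGroup K] [Module R K] (hM : IsMCM R M) (hK : Module.Finite R K)
    (hvan : ∀ j, dim R < j →
      Subsingleton (Ext (ModuleCat.of R (R ⧸ maximalIdeal R)) (ModuleCat.of R K) j))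
    (rs : List R) (hlen : rs.length = dim R) (hrad : (Ideal.ofList rs).radical = maximalIdeal R)
    (i : ℕ) (hi : 0 < i) : Subsingleton (Ext (ModuleCat.of R M) (ModuleCat.of R K) i) := by
  have := hM.finite
  have hm : ∀ r ∈ rs, r ∈ maximalIdeal R := fun r hr => by
    rw [← hrad]
    exact Ideal.le_radical (Ideal.subset_span hr)
  exact subsingleton_ext_of_lt_add_length (ModuleCat.of R K) (dim R) hvan rs hm M
    (hM.isWeaklyRegular rs hlen hrad)
    (hrad.symm.le.trans (Ideal.radical_mono le_sup_left)) i (by omega)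

/-- If `M ⧸ q M` is faithful over `R ⧸ q` then every element of `K` is a sum of values of
homomorphisms `M → K`. -/
lemma surjective_evalMap_of_faithful {M K : Type u} [AddCommGroup M] [Module R M]
    [AddCommGroup K] [Module R K] (hM : IsMCM R M) (hK : IsMCM R K)
    (hvan : ∀ j, dim R < j →
      Subsingleton (Ext (ModuleCat.of R (R ⧸ maximalIdeal R)) (ModuleCat.of R K) j))
    (rs : List R) (hlen : rs.length = dim R) (hrad : (Ideal.ofList rs).radical = maximalIdeal R)
    (hf : ∀ r : R, (∀ x : M, r • x ∈ (Ideal.ofList rs • ⊤ : Submodule R M)) →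
      r ∈ Ideal.ofList rs) :
    Function.Surjective (evalMap R M K) := by
  have := hM.finite
  have := hK.finite
  set q := Ideal.ofList rs
  have hqj : q ≤ Ideal.jacobson ⊥ :=
    (Ideal.le_radical.trans hrad.le).trans (maximalIdeal_le_jacobson _)
  refine LinearMap.surjective_of_surjective_comp_mkQ (I := q) _ hqj fun e => ?_
  obtain ⟨e, rfl⟩ := Submodule.Quotient.mk_surjective _ e
  obtain ⟨n, s, hs⟩ := Module.Finite.exists_fin (R := R) (M := M)
  let E := K ⧸ (q • ⊤ : Submodule R K)
  let M' := M ⧸ (q • ⊤ : Submodule R M)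
  -- The map `1 ↦ (s₁, …, sₙ)` from `R ⧸ q` to `(M ⧸ qM)ⁿ`, with `s` generating `M`. Its kernel is
  -- the annihilator of `M ⧸ qM`, so faithfulness makes it injective.
  have hker : q ≤ LinearMap.ker (LinearMap.pi fun i : Fin n =>
      LinearMap.toSpanSingleton R M' (Submodule.Quotient.mk (s i))) := by
    intro r hr
    ext i
    exact (Submodule.Quotient.mk_eq_zero _).mpr (Submodule.smul_mem_smul hr trivial)
  let j : (R ⧸ q) →ₗ[R] (Fin n → M') := Submodule.liftQ q _ hker
  have hj : Function.Injective j := by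
    refine (injective_iff_map_eq_zero j).mpr fun r hr => ?_
    obtain ⟨r, rfl⟩ := Submodule.Quotient.mk_surjective _ r
    refine (Submodule.Quotient.mk_eq_zero _).mpr (hf r fun x => ?_)
    have hx : x ∈ Submodule.span R (Set.range s) := hs ▸ trivial
    induction hx using Submodule.span_induction with
    | mem x hx =>
      obtain ⟨i, rfl⟩ := hx
      exact (Submodule.Quotient.mk_eq_zero _).mp (congrFun hr i)
    | zero => simp
    | add x y _ _ hx hy => rw [smul_add]; exact add_mem hx hy
    | smul a x _ hx => rw [smul_comm]; exact Submodule.smul_mem _ _ hx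
  have hann : ∀ r ∈ rs, r ∈ Module.annihilator R (Fin n → M') := fun r hr =>
    Module.mem_annihilator.mpr fun x => funext fun i =>
      Module.mem_annihilator.mp (mem_annihilator_of_mem_ofList rs M r hr) (x i)
  have hext : Subsingleton (Ext (ModuleCat.of R ((Fin n → M') ⧸ LinearMap.range j))
      (ModuleCat.of R K) (rs.length + 1)) := by
    refine subsingleton_ext_of_maximalIdeal_le_radical _ _ (hvan _ (by omega)) _
      (hrad.symm.le.trans (Ideal.radical_mono ?_))
    refine le_trans ?_ (LinearMap.annihilator_le_of_surjective _ (Submodule.mkQ_surjective _))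
    exact Ideal.span_le.mpr hann
  let φ : (R ⧸ q) →ₗ[R] E := Submodule.liftQ q
    (LinearMap.toSpanSingleton R E (Submodule.Quotient.mk e)) fun r hr =>
      (Submodule.Quotient.mk_eq_zero _).mpr (Submodule.smul_mem_smul hr trivial)
  obtain ⟨ψ, hψ⟩ := exists_extension_of_isWeaklyRegular rs (hK.isWeaklyRegular rs hlen hrad)
    j hj hann hext φ
  choose f hf using fun i : Fin n => exists_lift_of_isWeaklyRegular M rs K
    (hK.isWeaklyRegular rs hlen hrad)
    (hM.subsingleton_ext_of_pos hK.finite hvan rs hlen hrad)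
    (ψ ∘ₗ LinearMap.single R (fun _ => M') i ∘ₗ Submodule.mkQ _)
  refine ⟨∑ i, f i ⊗ₜ[R] s i, ?_⟩
  have h1 : ψ (j (Submodule.Quotient.mk 1)) = φ (Submodule.Quotient.mk 1) :=
    LinearMap.congr_fun hψ _
  have h2 : φ (Submodule.Quotient.mk 1) = Submodule.Quotient.mk e := by
    change (1 : R) • (Submodule.Quotient.mk e : E) = _
    exact one_smul R _
  have h3 : j (Submodule.Quotient.mk 1) =
      ∑ i, LinearMap.single R (fun _ => M') i (Submodule.Quotient.mk (s i)) := by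
    have : j (Submodule.Quotient.mk 1) = fun i => Submodule.Quotient.mk (s i) :=
      funext fun i => one_smul R (Submodule.Quotient.mk (s i) : M')
    rw [this]
    exact (LinearMap.sum_single_apply _ _).symm
  rw [← h2, ← h1, h3, map_sum, map_sum]
  refine Finset.sum_congr rfl fun i _ => ?_
  exact LinearMap.congr_fun (hf i) (s i)

/-- If the evaluation map is surjective then `M ⧸ q M` is faithful over `R ⧸ q`. -/
lemma faithful_of_surjective_evalMap {M K : Type u} [AddCommGroup M] [Module R M]
    [AddCommGroup K] [Module R K] (hK : IsMCM R K)
    (hvan : ∀ j, dim R < j →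
      Subsingleton (Ext (ModuleCat.of R (R ⧸ maximalIdeal R)) (ModuleCat.of R K) j))
    (rs : List R) (hlen : rs.length = dim R) (hrad : (Ideal.ofList rs).radical = maximalIdeal R)
    (hsurj : Function.Surjective (evalMap R M K)) (r : R)
    (hr : ∀ x : M, r • x ∈ (Ideal.ofList rs • ⊤ : Submodule R M)) : r ∈ Ideal.ofList rs := by
  have := hK.finite
  have := hK.nontrivial
  set q := Ideal.ofList rs
  -- `K` is spanned by values `f x`, and `r • f x = f (r • x)` lies in `qK`.
  have hrK : ∀ e : K, r • e ∈ (q • ⊤ : Submodule R K) := by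
    intro e
    obtain ⟨t, rfl⟩ := hsurj e
    induction t using TensorProduct.induction_on with
    | zero => simp
    | add x y hx hy => rw [map_add, smul_add]; exact add_mem hx hy
    | tmul f x =>
      rw [evalMap_tmul, ← map_smul]
      have h1 := Submodule.mem_map_of_mem (f := f) (hr x)
      rw [Submodule.map_smul''] at h1
      exact Submodule.smul_mono le_rfl le_top h1
  by_contra hrq
  let E := K ⧸ (q • ⊤ : Submodule R K)
  let x : R ⧸ q := Submodule.Quotient.mk r
  have hannq : Module.annihilator R (R ⧸ q) = q := Ideal.annihilator_quotient
  let S := Submodule.span R {x}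
  have hS : Nontrivial S := by
    refine ⟨⟨x, Submodule.mem_span_singleton_self x⟩, 0, fun h => hrq ?_⟩
    exact (Submodule.Quotient.mk_eq_zero _).mp (congrArg Subtype.val h)
  have hqE : q ≤ Module.annihilator R E := Ideal.span_le.mpr (mem_annihilator_of_mem_ofList rs K)
  have hE : Nontrivial E := Submodule.Quotient.nontrivial_iff.mpr
    (Submodule.top_ne_ideal_smul_of_le_jacobson_annihilator
      ((Ideal.le_radical.trans hrad.le).trans (maximalIdeal_le_jacobson _))).symm
  obtain ⟨g, hg⟩ := exists_injective_residue S (hrad.symm.le.trans (Ideal.radical_mono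
    (hannq.symm.le.trans (S.subtype.annihilator_le_of_injective S.injective_subtype))))
  obtain ⟨φ, hφ⟩ := exists_injective_residue E (hrad.symm.le.trans (Ideal.radical_mono hqE))
  have hann : ∀ r ∈ rs, r ∈ Module.annihilator R (R ⧸ q) := fun r hr => by
    rw [hannq]
    exact Ideal.subset_span hr
  -- If `r ∉ q`, then `k` embeds in the submodule generated by the class of `r`. An embedding of `k`
  -- in `K ⧸ qK` extends to `ψ` on `R ⧸ q`, and then `φ 1 = a • r • ψ 1 = 0`, contradicting
  -- injectivity.
  obtain ⟨ψ, hψ⟩ := exists_extension_of_isWeaklyRegular rs (hK.isWeaklyRegular rs hlen hrad)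
    (S.subtype ∘ₗ g) (S.injective_subtype.comp hg) hann
    (subsingleton_ext_of_maximalIdeal_le_radical _ _ (hvan _ (by omega)) _
      (hrad.symm.le.trans (Ideal.radical_mono (hannq.symm.le.trans
        (LinearMap.annihilator_le_of_surjective _ (Submodule.mkQ_surjective _)))))) φ
  obtain ⟨a, ha⟩ := Submodule.mem_span_singleton.mp (g 1).2
  have h1 : φ 1 = ψ (a • x) := by rw [ha, ← hψ]; rfl
  have h2 : a • x = (a * r) • (1 : R ⧸ q) := by
    rw [mul_smul]
    congr 1
    change _ = (Submodule.Quotient.mk (r • 1) : R ⧸ q)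
    rw [smul_eq_mul, mul_one]
  have h3 : φ 1 = 0 := by
    rw [h1, h2, map_smul, mul_smul]
    obtain ⟨e, he⟩ := Submodule.Quotient.mk_surjective _ (ψ 1)
    rw [← he, ← Submodule.Quotient.mk_smul, (Submodule.Quotient.mk_eq_zero _).mpr (hrK e), smul_zero]
  have := hφ (h3.trans (map_zero φ).symm)
  have hnt : Nontrivial (R ⧸ maximalIdeal R) :=
    Ideal.Quotient.nontrivial_iff.mpr (maximalIdeal.isMaximal R).ne_top
  exact one_ne_zero this

end Evaluation

/-! ### Type as length of a socle -/

section Socle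

/-- Homomorphisms from `R ⧸ I` are the elements killed by `I`. -/
def quotientHomEquiv {R : Type u} [CommRing R] (I : Ideal R) (X : Type u) [AddCommGroup X]
    [Module R X] : ((R ⧸ I) →ₗ[R] X) ≃ₗ[R] Submodule.torsionBySet R X (I : Set R) :=
  LinearEquiv.ofBijective
    (LinearMap.codRestrict _ (LinearMap.applyₗ (1 : R ⧸ I)) fun f => by
      rw [Submodule.mem_torsionBySet_iff]
      rintro ⟨a, ha⟩
      change a • f 1 = 0
      rw [← map_smul]
      have : a • (1 : R ⧸ I) = 0 := by
        rw [← map_one (Ideal.Quotient.mk I), ← Ideal.Quotient.mk_eq_mk,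
          ← Submodule.Quotient.mk_smul, Submodule.Quotient.mk_eq_zero, smul_eq_mul, mul_one]
        exact ha
      rw [this, map_zero]) <| by
    constructor
    · intro f g h
      have h1 : f 1 = g 1 := congrArg Subtype.val h
      refine Submodule.linearMap_qext _ (LinearMap.ext_ring ?_)
      exact h1
    · rintro ⟨x, hx⟩
      rw [Submodule.mem_torsionBySet_iff] at hx
      refine ⟨Submodule.liftQ I (LinearMap.toSpanSingleton R X x) fun a ha => hx ⟨a, ha⟩, ?_⟩
      exact Subtype.ext (one_smul R x)

lemma cmType_eq_length {R : Type u} [CommRing R] [IsLocalRing R] (L : Type u) [AddCommGroup L]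
    [Module R L] (rs : List R) (hlen : rs.length = dim R) (hrs : ∀ r ∈ rs, r ∈ maximalIdeal R)
    (reg : IsWeaklyRegular L rs) :
    cmType R L = Module.length R (Submodule.torsionBySet R
      (L ⧸ (Ideal.ofList rs • ⊤ : Submodule R L)) (maximalIdeal R : Set R)) := by
  obtain ⟨θ, hθ⟩ := exists_ext_comp_bijective rs (ModuleCat.of R L) reg
  have h := hθ (ModuleCat.of R (R ⧸ maximalIdeal R)) fun r hr => by
    change r ∈ Module.annihilator R (R ⧸ maximalIdeal R)
    rw [Ideal.annihilator_quotient]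
    exact hrs r hr
  rw [cmType, ← hlen]
  let e1 := LinearEquiv.ofBijective (θ.postcompOfLinear R
    (ModuleCat.of R (R ⧸ maximalIdeal R)) (zero_add _)) h
  exact (e1.symm.trans ((Ext.linearEquiv₀.trans ModuleCat.homLinearEquiv).trans
    (quotientHomEquiv _ _))).length_eq

/-- The `R`-submodules and the `A`-submodules of `T` are the same. -/
lemma length_eq_of_forall_exists_smul_eq {R A T : Type*} [CommRing R] [CommRing A] [Algebra R A]
    [AddCommGroup T] [Module R T] [Module A T] [IsScalarTower R A T]
    (h : ∀ a : A, ∃ r : R, ∀ t : T, a • t = r • t) : Module.length R T = Module.length A T := by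
  let e : Submodule A T ≃o Submodule R T :=
    { toFun := Submodule.restrictScalars R
      invFun := fun S =>
        { S with
          smul_mem' := fun a x hx => by
            obtain ⟨r, hr⟩ := h a
            rw [hr]
            exact S.smul_mem r hx }
      left_inv := fun _ => rfl
      right_inv := fun _ => rfl
      map_rel_iff' := Iff.rfl }
  rw [Module.length, Module.length, WithBot.unbot_inj, Order.krullDim_eq_of_orderIso e]

lemma length_ne_top_of_maximalIdeal_le_radical {R : Type u} [CommRing R] [IsLocalRing R]
    [IsNoetherianRing R] (N : Type u) [AddCommGroup N] [Module R N] [hN : Module.Finite R N]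
    (h : maximalIdeal R ≤ (Module.annihilator R N).radical) : Module.length R N ≠ ⊤ := by
  revert h
  induction hN using IsNoetherianRing.induction_on_isQuotientEquivQuotientPrime R with
  | subsingleton N =>
    intro _
    simp [Module.length_eq_zero]
  | quotient N p f =>
    intro h
    rw [f.annihilator_eq, Ideal.annihilator_quotient] at h
    rw [f.length_eq, eq_maximalIdeal_of_le_radical p.2 h le_rfl]
    have : IsSimpleModule R (R ⧸ maximalIdeal R) :=
      isSimpleModule_iff_isCoatom.mpr (maximalIdeal.isMaximal R).out
    simp [Module.length_eq_one]
  | exact N₁ N₂ N₃ f g hf hg hfg h₁ h₃ =>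
    intro h
    rw [Module.length_eq_add_of_exact f g hf hg hfg]
    exact WithTop.add_ne_top.mpr
      ⟨h₁ (h.trans (Ideal.radical_mono (f.annihilator_le_of_injective hf))),
        h₃ (h.trans (Ideal.radical_mono (g.annihilator_le_of_surjective hg)))⟩

end Socle

/-! ### Ideals, dimension and quotients of the idealization -/

section IdealizationAlgebra

namespace Idealization

section

variable {R M : Type u}

/-- The first component of an element of `R ⋉ M`. -/
def fst (z : Idealization R M) : R := TrivSqZeroExt.fst z

/-- The second component of an element of `R ⋉ M`. -/
def snd (z : Idealization R M) : M := TrivSqZeroExt.snd z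

@[simp] lemma fst_mk (a : R) (x : M) : (mk a x).fst = a := rfl

@[simp] lemma snd_mk (a : R) (x : M) : (mk a x).snd = x := rfl

@[simp] lemma mk_fst_snd (z : Idealization R M) : mk z.fst z.snd = z := rfl

lemma ext {z w : Idealization R M} (h1 : z.fst = w.fst) (h2 : z.snd = w.snd) : z = w :=
  Prod.ext h1 h2

end

variable {R M : Type u} [CommRing R] [AddCommGroup M] [Module R M]

lemma fst_add (z w : Idealization R M) : (z + w).fst = z.fst + w.fst := rfl

lemma snd_add (z w : Idealization R M) : (z + w).snd = z.snd + w.snd := rfl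

lemma fst_mul (z w : Idealization R M) : (z * w).fst = z.fst * w.fst := rfl

lemma snd_mul (z w : Idealization R M) :
    (z * w).snd = z.fst • w.snd + w.fst • z.snd := rfl

lemma fst_one : (1 : Idealization R M).fst = 1 := rfl

instance : Algebra R (Idealization R M) :=
  RingHom.toAlgebra
    { toFun := fun r => mk r 0
      map_one' := rfl
      map_mul' := fun a b => by rw [mk_mul_mk]; simp
      map_zero' := rfl
      map_add' := fun a b => by rw [mk_add_mk, add_zero] }

lemma fst_smul (r : R) (z : Idealization R M) : (r • z).fst = r * z.fst := rfl

lemma snd_smul (r : R) (z : Idealization R M) : (r • z).snd = r • z.snd := by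
  rw [Algebra.smul_def, snd_mul]
  exact (add_eq_left.mpr (smul_zero _))

/-- The first projection as a linear map. -/
def fstₗ : Idealization R M →ₗ[R] R where
  toFun := fst
  map_add' := fst_add
  map_smul' := fst_smul

/-- The second projection as a linear map. -/
def sndₗ : Idealization R M →ₗ[R] M where
  toFun := snd
  map_add' := snd_add
  map_smul' := snd_smul

/-- The inclusion of `R` as a linear map. -/
def inlₗ : R →ₗ[R] Idealization R M where
  toFun r := mk r 0
  map_add' a b := ext rfl (add_zero 0).symm
  map_smul' a b := ext rfl (by rw [snd_smul]; exact (smul_zero a).symm)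

/-- The inclusion of `M` as a linear map. -/
def inrₗ : M →ₗ[R] Idealization R M where
  toFun x := mk 0 x
  map_add' a b := ext (add_zero 0).symm rfl
  map_smul' a b := ext (by rw [fst_smul]; exact (mul_zero a).symm) (by rw [snd_smul]; rfl)

lemma inlₗ_add_inrₗ (z : Idealization R M) : inlₗ z.fst + inrₗ z.snd = z :=
  ext (add_zero _) (zero_add _)

lemma mk_eq (a : R) (x : M) : mk a x = algebraMap R (Idealization R M) a + mk 0 x :=
  (inlₗ_add_inrₗ (mk a x)).symm

/-- The module underlying `R ⋉ M` is `R × M`. -/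
def equivProd : Idealization R M ≃ₗ[R] R × M where
  toFun z := (z.fst, z.snd)
  invFun p := mk p.1 p.2
  map_add' _ _ := rfl
  map_smul' r z := Prod.ext (fst_smul r z) (snd_smul r z)
  left_inv _ := rfl
  right_inv _ := rfl

instance [Module.Finite R M] : Module.Finite R (Idealization R M) :=
  .equiv equivProd.symm

lemma isUnit_iff (z : Idealization R M) : IsUnit z ↔ IsUnit z.fst := by
  constructor
  · intro h
    obtain ⟨w, hw⟩ := h.exists_right_inv
    exact .of_mul_eq_one w.fst (by rw [← fst_mul, hw, fst_one])
  · intro h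
    obtain ⟨s, hs⟩ := h.exists_right_inv
    refine .of_mul_eq_one (mk s (-(s * s) • z.snd)) (ext ?_ ?_)
    · rw [fst_mul, fst_mk, hs, fst_one]
    · rw [snd_mul, fst_mk, snd_mk, smul_smul, mul_neg, ← mul_assoc, hs, one_mul, neg_smul,
        neg_add_cancel]
      rfl

lemma mem_maximalIdeal_iff [IsLocalRing R] (z : Idealization R M) :
    z ∈ maximalIdeal (Idealization R M) ↔ z.fst ∈ maximalIdeal R := by
  rw [mem_maximalIdeal, mem_nonunits_iff, mem_maximalIdeal, mem_nonunits_iff, isUnit_iff]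

/-- The elements `(0, x)` square to zero, so they lie in every prime. -/
lemma mem_iff_fst_mem (p : Ideal (Idealization R M)) [p.IsPrime] (z : Idealization R M) :
    z ∈ p ↔ algebraMap R (Idealization R M) z.fst ∈ p := by
  have h : mk 0 z.snd ∈ p := by
    refine Ideal.IsPrime.mem_of_pow_mem ‹_› 2 ?_
    rw [pow_two, mk_mul_mk, zero_smul, mul_zero, add_zero]
    exact zero_mem p
  conv_lhs => rw [← mk_fst_snd z, mk_eq, add_mem_cancel_right h]

lemma ringKrullDim_eq : ringKrullDim (Idealization R M) = ringKrullDim R := by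
  refine le_antisymm ?_ ?_
  · have hle : ∀ p q : PrimeSpectrum (Idealization R M),
        p.comap (algebraMap R _) ≤ q.comap (algebraMap R _) → p ≤ q := by
      intro p q h z hz
      have := p.2
      have := q.2
      rw [mem_iff_fst_mem] at hz ⊢
      exact h hz
    refine Order.krullDim_le_of_strictMono (fun p => p.comap (algebraMap R (Idealization R M)))
      fun p q hpq => lt_of_le_not_ge (fun r hr => hpq.le hr) fun h => hpq.not_ge (hle q p h)
  · exact ringKrullDim_le_of_surjective
      (⟨⟨⟨fst, rfl⟩, fst_mul⟩, rfl, fst_add⟩ : Idealization R M →+* R)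
      fun r => ⟨mk r 0, rfl⟩

lemma dim_eq : dim (Idealization R M) = dim R := by
  rw [dim, dim, ringKrullDim_eq]

lemma mem_smul_top_iff (q : Ideal R) (z : Idealization R M) :
    z ∈ (q • ⊤ : Submodule R (Idealization R M)) ↔
      z.fst ∈ q ∧ z.snd ∈ (q • ⊤ : Submodule R M) := by
  constructor
  · intro hz
    constructor
    · have h := Submodule.mem_map_of_mem (f := fstₗ) hz
      rw [Submodule.map_smul''] at h
      have h' : z.fst ∈ (q • ⊤ : Submodule R R) := Submodule.smul_mono le_rfl le_top h
      simpa using h'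
    · have h := Submodule.mem_map_of_mem (f := sndₗ) hz
      rw [Submodule.map_smul''] at h
      exact Submodule.smul_mono le_rfl le_top h
  · rintro ⟨h1, h2⟩
    rw [← inlₗ_add_inrₗ z]
    refine add_mem ?_ ?_
    · have h1' : z.fst ∈ (q • ⊤ : Submodule R R) := by simpa using h1
      have h := Submodule.mem_map_of_mem (f := inlₗ (M := M)) h1'
      rw [Submodule.map_smul''] at h
      exact Submodule.smul_mono le_rfl le_top h
    · have h := Submodule.mem_map_of_mem (f := inrₗ (R := R)) h2
      rw [Submodule.map_smul''] at h
      exact Submodule.smul_mono le_rfl le_top h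

lemma mem_ofList_map_smul_top_iff (rs : List R) (z : Idealization R M) :
    z ∈ (Ideal.ofList (rs.map (algebraMap R (Idealization R M))) • ⊤ :
      Submodule (Idealization R M) (Idealization R M)) ↔
      z.fst ∈ Ideal.ofList rs ∧ z.snd ∈ (Ideal.ofList rs • ⊤ : Submodule R M) := by
  rw [← mem_smul_top_iff, ← Ideal.map_ofList, smul_eq_mul, Ideal.mul_top, Ideal.smul_top_eq_map]
  rfl

end Idealization

end IdealizationAlgebra

/-! ### The Cohen-Macaulay type of the idealization -/

section IdealizationType

open Idealization

variable {R : Type u} [CommRing R]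

lemma isWeaklyRegular_idealization [IsLocalRing R] [IsNoetherianRing R] {M : Type u} [AddCommGroup M] [Module R M]
    (hR : IsMCM R R) (hM : IsMCM R M) (rs : List R) (hlen : rs.length = dim R)
    (hrad : (Ideal.ofList rs).radical = maximalIdeal R) :
    IsWeaklyRegular (Idealization R M) (rs.map (algebraMap R (Idealization R M))) := by
  have := hM.finite
  rw [isWeaklyRegular_map_algebraMap_iff]
  -- As an `R`-module, `R ⋉ M` is an extension of `M` by `R`, so `Ext^i(k, -)` vanishes on it below
  -- `d` because it does on both ends.
  have hexact : Function.Exact (inlₗ : R →ₗ[R] Idealization R M) sndₗ := fun z =>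
    ⟨fun h => ⟨z.fst, Idealization.ext rfl h.symm⟩, fun ⟨r, hr⟩ => hr ▸ rfl⟩
  have hS := linearComplex_shortExact hexact
    (fun a b h => congrArg Idealization.fst h) (fun x => ⟨mk 0 x, rfl⟩)
  refine isWeaklyRegular_of_subsingleton_ext rs (fun r hr => ?_) _ (fun i hi => ?_)
    (hrad.symm.le.trans (Ideal.radical_mono le_sup_left))
  · rw [← hrad]
    exact Ideal.le_radical (Ideal.subset_span hr)
  · have h1 := hR.subsingleton_ext i (hlen ▸ hi)
    have h2 := hM.subsingleton_ext i (hlen ▸ hi)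
    refine subsingleton_of_forall_eq 0 fun x => ?_
    obtain ⟨y, rfl⟩ := Ext.covariant_sequence_exact₂ _ hS x (Subsingleton.elim _ _)
    rw [Subsingleton.elim y 0, Ext.zero_comp]

variable {M : Type u} [AddCommGroup M] [Module R M] (rs : List R)

/-- The ideal of `R ⋉ M` generated by elements of `R`. -/
abbrev idealizationIdeal (M : Type u) [AddCommGroup M] [Module R M] (rs : List R) :
    Submodule (Idealization R M) (Idealization R M) :=
  Ideal.ofList (rs.map (algebraMap R (Idealization R M))) • ⊤

/-- The projection from `R ⋉ M` modulo `q` to `R ⧸ q`. -/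
def quotientFst : (Idealization R M ⧸ idealizationIdeal M rs) →ₗ[R] R ⧸ Ideal.ofList rs :=
  Submodule.liftQ ((idealizationIdeal M rs).restrictScalars R)
      (Submodule.mkQ (Ideal.ofList rs) ∘ₗ fstₗ) (fun z hz => by
    refine (Submodule.Quotient.mk_eq_zero _).mpr ?_
    exact ((mem_ofList_map_smul_top_iff rs z).mp hz).1) ∘ₗ
    (Submodule.Quotient.restrictScalarsEquiv R (idealizationIdeal M rs)).symm.toLinearMap

/-- The inclusion of `M ⧸ q M` in `R ⋉ M` modulo `q`. -/
def quotientInr : (M ⧸ (Ideal.ofList rs • ⊤ : Submodule R M)) →ₗ[R]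
    Idealization R M ⧸ idealizationIdeal M rs :=
  Submodule.liftQ _ ((idealizationIdeal M rs).mkQ.restrictScalars R ∘ₗ inrₗ) fun _ hx =>
    (Submodule.Quotient.mk_eq_zero _).mpr
      ((mem_ofList_map_smul_top_iff rs _).mpr ⟨zero_mem _, hx⟩)

lemma quotientInr_mk (x : M) :
    quotientInr rs (Submodule.Quotient.mk x) = Submodule.Quotient.mk (mk 0 x) := rfl

lemma quotientInr_injective : Function.Injective (quotientInr (M := M) rs) := by
  refine (injective_iff_map_eq_zero _).mpr fun x hx => ?_
  obtain ⟨x, rfl⟩ := Submodule.Quotient.mk_surjective _ x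
  rw [quotientInr_mk, Submodule.Quotient.mk_eq_zero, mem_ofList_map_smul_top_iff] at hx
  exact (Submodule.Quotient.mk_eq_zero _).mpr hx.2

variable [IsLocalRing R]

/-- The socle of `M ⧸ q M`. -/
abbrev moduleSocle (M : Type u) [AddCommGroup M] [Module R M] (rs : List R) :
    Submodule R (M ⧸ (Ideal.ofList rs • ⊤ : Submodule R M)) :=
  Submodule.torsionBySet R _ (maximalIdeal R : Set R)

/-- The socle of `R ⋉ M` modulo `q`. -/
abbrev idealizationSocle (M : Type u) [AddCommGroup M] [Module R M] (rs : List R) :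
    Submodule (Idealization R M) (Idealization R M ⧸ idealizationIdeal M rs) :=
  Submodule.torsionBySet _ _ (maximalIdeal (Idealization R M) : Set (Idealization R M))

lemma mk_mem_idealizationSocle_iff (z : Idealization R M) :
    Submodule.Quotient.mk z ∈ idealizationSocle M rs ↔
      ∀ w : Idealization R M, w.fst ∈ maximalIdeal R →
        w.fst * z.fst ∈ Ideal.ofList rs ∧
          w.fst • z.snd + z.fst • w.snd ∈ (Ideal.ofList rs • ⊤ : Submodule R M) := by
  rw [Submodule.mem_torsionBySet_iff]
  have key : ∀ w : Idealization R M,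
      w • (Submodule.Quotient.mk z : Idealization R M ⧸ idealizationIdeal M rs) = 0 ↔
        w.fst * z.fst ∈ Ideal.ofList rs ∧
          w.fst • z.snd + z.fst • w.snd ∈ (Ideal.ofList rs • ⊤ : Submodule R M) := fun w => by
    rw [← Submodule.Quotient.mk_smul, Submodule.Quotient.mk_eq_zero, mem_ofList_map_smul_top_iff,
      smul_eq_mul, fst_mul, snd_mul]
  exact ⟨fun h w hw => (key w).mp (h ⟨w, (mem_maximalIdeal_iff w).mpr hw⟩),
    fun h w => (key w).mpr (h w ((mem_maximalIdeal_iff _).mp w.2))⟩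

lemma quotientInr_mem_iff (x : M ⧸ (Ideal.ofList rs • ⊤ : Submodule R M)) :
    quotientInr rs x ∈ idealizationSocle M rs ↔ x ∈ moduleSocle M rs := by
  obtain ⟨x, rfl⟩ := Submodule.Quotient.mk_surjective _ x
  rw [quotientInr_mk, mk_mem_idealizationSocle_iff, Submodule.mem_torsionBySet_iff]
  simp only [fst_mk, snd_mk, mul_zero, zero_smul, add_zero]
  constructor
  · intro h a
    rw [← Submodule.Quotient.mk_smul]
    exact (Submodule.Quotient.mk_eq_zero _).mpr (h (mk a.1 0) a.2).2
  · intro h w hw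
    refine ⟨zero_mem _, (Submodule.Quotient.mk_eq_zero _).mp ?_⟩
    exact h ⟨w.fst, hw⟩

/-- The first component of an element of the socle. -/
def socleFst (M : Type u) [AddCommGroup M] [Module R M] (rs : List R) :
    idealizationSocle M rs →ₗ[R] R ⧸ Ideal.ofList rs :=
  quotientFst rs ∘ₗ (idealizationSocle M rs).subtype.restrictScalars R

lemma length_idealizationSocle : Module.length (Idealization R M) (idealizationSocle M rs) =
    Module.length R (moduleSocle M rs) + Module.length R (LinearMap.range (socleFst M rs)) := by
  rw [← length_eq_of_forall_exists_smul_eq (R := R)]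
  · let f : moduleSocle M rs →ₗ[R] idealizationSocle M rs :=
      { toFun := fun x => ⟨quotientInr rs x, (quotientInr_mem_iff rs _).mpr x.2⟩
        map_add' := fun x y => Subtype.ext (map_add _ _ _)
        map_smul' := fun r x => Subtype.ext (map_smul _ _ _) }
    refine Module.length_eq_add_of_exact f (socleFst M rs).rangeRestrict ?_
      (LinearMap.surjective_rangeRestrict _) ?_
    · exact fun x y h => Subtype.ext (quotientInr_injective rs (congrArg Subtype.val h))
    · rintro ⟨t, ht⟩
      obtain ⟨z, rfl⟩ := Submodule.Quotient.mk_surjective _ t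
      constructor
      · intro h
        have h1 : z.fst ∈ Ideal.ofList rs :=
          (Submodule.Quotient.mk_eq_zero _).mp (congrArg Subtype.val h)
        have h2 : quotientInr rs (Submodule.Quotient.mk z.snd) =
            (Submodule.Quotient.mk z : Idealization R M ⧸ idealizationIdeal M rs) := by
          rw [quotientInr_mk, Submodule.Quotient.eq, mem_ofList_map_smul_top_iff]
          constructor
          · have : (mk 0 z.snd - z).fst = -z.fst := zero_sub z.fst
            rw [this]
            exact neg_mem h1
          · have : (mk 0 z.snd - z).snd = 0 := sub_self z.snd
            rw [this]
            exact zero_mem _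
        exact ⟨⟨Submodule.Quotient.mk z.snd, (quotientInr_mem_iff rs _).mp (h2 ▸ ht)⟩,
          Subtype.ext h2⟩
      · rintro ⟨⟨x, hx⟩, h⟩
        obtain ⟨x, rfl⟩ := Submodule.Quotient.mk_surjective _ x
        rw [← h]
        exact Subtype.ext ((Submodule.Quotient.mk_eq_zero _).mpr (zero_mem _))
  -- `(0, x)` lies in the maximal ideal and kills the socle, so `R ⋉ M` acts on the socle through
  -- `R`.
  · intro a
    refine ⟨a.fst, fun t => ?_⟩
    have h : (mk 0 a.snd : Idealization R M) • t = 0 := by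
      refine Subtype.ext ?_
      exact (Submodule.mem_torsionBySet_iff _ _).mp t.2
        ⟨mk 0 a.snd, (mem_maximalIdeal_iff _).mpr (zero_mem _)⟩
    conv_lhs => rw [← mk_fst_snd a, mk_eq, add_smul, h, add_zero, algebraMap_smul]

/-- Testing `(a, x)` against `(0, y)` shows that the first component of a socle element kills `M ⧸
qM`. Conversely, if `r ∉ q` kills `M ⧸ qM`, some multiple `a * r` is a nonzero socle element of `R ⧸
q`, and `(a * r, 0)` lies in the socle. -/
lemma range_socleFst_eq_bot_iff [IsNoetherianRing R]
    (hrad : (Ideal.ofList rs).radical = maximalIdeal R) :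
    LinearMap.range (socleFst M rs) = ⊥ ↔
      ∀ r : R, (∀ x : M, r • x ∈ (Ideal.ofList rs • ⊤ : Submodule R M)) → r ∈ Ideal.ofList rs := by
  rw [LinearMap.range_eq_bot]
  constructor
  · intro h r hr
    by_contra hrq
    let x : R ⧸ Ideal.ofList rs := Submodule.Quotient.mk r
    let S := Submodule.span R {x}
    have hS : Nontrivial S := by
      refine ⟨⟨x, Submodule.mem_span_singleton_self x⟩, 0, fun h => hrq ?_⟩
      exact (Submodule.Quotient.mk_eq_zero _).mp (congrArg Subtype.val h)
    have hannq : Module.annihilator R (R ⧸ Ideal.ofList rs) = Ideal.ofList rs :=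
      Ideal.annihilator_quotient
    obtain ⟨g, hg⟩ := exists_injective_residue S (hrad.symm.le.trans (Ideal.radical_mono
      (hannq.symm.le.trans (S.subtype.annihilator_le_of_injective S.injective_subtype))))
    obtain ⟨a, ha⟩ := Submodule.mem_span_singleton.mp (g 1).2
    have ha' : (Submodule.Quotient.mk (a * r) : R ⧸ Ideal.ofList rs) = g 1 := ha
    have hkill : ∀ w ∈ maximalIdeal R, w * (a * r) ∈ Ideal.ofList rs := by
      intro w hw
      refine (Submodule.Quotient.mk_eq_zero (Ideal.ofList rs)).mp ?_
      have h1 : w • (1 : R ⧸ maximalIdeal R) = 0 :=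
        (quotientHomEquiv (maximalIdeal R) (R ⧸ maximalIdeal R) LinearMap.id).2 |>
          fun h => (Submodule.mem_torsionBySet_iff _ _).mp h ⟨w, hw⟩
      change (Submodule.Quotient.mk (w • (a * r)) : R ⧸ Ideal.ofList rs) = 0
      rw [Submodule.Quotient.mk_smul, ha', ← Submodule.coe_smul, ← map_smul, h1, map_zero]
      rfl
    have hmem : (Submodule.Quotient.mk (mk (a * r) 0) :
        Idealization R M ⧸ idealizationIdeal M rs) ∈ idealizationSocle M rs := by
      rw [mk_mem_idealizationSocle_iff]
      intro w hw
      refine ⟨hkill _ hw, ?_⟩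
      rw [snd_mk, fst_mk, smul_zero, zero_add, mul_smul]
      exact Submodule.smul_mem _ _ (hr _)
    have h0 := LinearMap.congr_fun h ⟨_, hmem⟩
    have h1 : (Submodule.Quotient.mk (a * r) : R ⧸ Ideal.ofList rs) = 0 := h0
    have h2 : g 1 = g 0 := by
      rw [map_zero]
      exact Subtype.ext (ha'.symm.trans h1)
    have hnt : Nontrivial (R ⧸ maximalIdeal R) :=
      Ideal.Quotient.nontrivial_iff.mpr (maximalIdeal.isMaximal R).ne_top
    exact one_ne_zero (hg h2)
  · intro h
    ext ⟨t, ht⟩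
    obtain ⟨z, rfl⟩ := Submodule.Quotient.mk_surjective _ t
    refine (Submodule.Quotient.mk_eq_zero _).mpr (h z.fst fun x => ?_)
    have := ((mk_mem_idealizationSocle_iff rs z).mp ht (mk 0 x) (zero_mem _)).2
    rwa [fst_mk, snd_mk, zero_smul, zero_add] at this

/-- The type of `R ⋉ M` is that of `M` exactly when `M ⧸ q M` is faithful over `R ⧸ q`. -/
lemma cmType_idealization_eq_iff [IsNoetherianRing R] (hR : IsMCM R R) (hM : IsMCM R M)
    (hlen : rs.length = dim R) (hrad : (Ideal.ofList rs).radical = maximalIdeal R) :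
    cmType (Idealization R M) (Idealization R M) = cmType R M ↔
      ∀ r : R, (∀ x : M, r • x ∈ (Ideal.ofList rs • ⊤ : Submodule R M)) → r ∈ Ideal.ofList rs := by
  have := hM.finite
  have hm : ∀ r ∈ rs, r ∈ maximalIdeal R := fun r hr => by
    rw [← hrad]
    exact Ideal.le_radical (Ideal.subset_span hr)
  rw [cmType_eq_length M rs hlen hm (hM.isWeaklyRegular rs hlen hrad),
    cmType_eq_length (Idealization R M) (rs.map (algebraMap R (Idealization R M)))
      (by rw [List.length_map, hlen, dim_eq]) (fun z hz => ?_)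
      (isWeaklyRegular_idealization hR hM rs hlen hrad), length_idealizationSocle,
    ← range_socleFst_eq_bot_iff rs hrad]
  -- Finite length permits cancelling the common summand.
  · have hfin : Module.length R (moduleSocle M rs) ≠ ⊤ := by
      refine length_ne_top_of_maximalIdeal_le_radical _ (hrad.symm.le.trans (Ideal.radical_mono ?_))
      refine le_trans ?_ ((moduleSocle M rs).subtype.annihilator_le_of_injective
        (Submodule.injective_subtype _))
      exact Ideal.span_le.mpr (mem_annihilator_of_mem_ofList rs M)
    rw [← Submodule.subsingleton_iff_eq_bot, ← Module.length_eq_zero_iff (R := R)]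
    constructor
    · intro h
      exact ENat.add_right_injective_of_ne_top hfin (h.trans (add_zero _).symm)
    · intro h
      rw [h, add_zero]
  · obtain ⟨r, hr, rfl⟩ := List.mem_map.mp hz
    exact (mem_maximalIdeal_iff _).mpr (hm r hr)

end IdealizationType

end CMType

end

theorem corollary3p4 {R : Type u} [CommRing R] [CMType.IsCMLocalRing R]
    {M : Type u} [AddCommGroup M] [Module R M] (hM : CMType.IsMCM R M)
    {K : Type u} [AddCommGroup K] [Module R K] (hK : CMType.IsCanonicalModule R K) :
    List.TFAE
      [CMType.cmType (CMType.Idealization R M) (CMType.Idealization R M) = CMType.cmType R M,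
       Function.Surjective (CMType.evalMap R M K),
       CMType.IsResiduallyFaithful R M] := by
  have hR : CMType.IsMCM R R := ⟨inferInstance, inferInstance, CMType.IsCMLocalRing.depth_eq⟩
  obtain ⟨n, hn⟩ := hK.finite_injectiveDimension
  obtain ⟨ys, hylen, hyrad⟩ := hR.exists_parameters
  have hyreg : RingTheory.Sequence.IsRegular R ys :=
    .of_isWeaklyRegular_of_mem_maximalIdeal R (fun r hr => by
      rw [← hyrad]
      exact Ideal.le_radical (Ideal.subset_span hr)) (hR.isWeaklyRegular ys hylen hyrad)
  have hvan : ∀ j, CMType.dim R < j → Subsingleton (CategoryTheory.Abelian.Ext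
      (ModuleCat.of R (R ⧸ IsLocalRing.maximalIdeal R)) (ModuleCat.of R K) j) := fun j hj =>
    CMType.subsingleton_ext_of_hasInjectiveDimensionLE (ModuleCat.of R K) n ys hyreg hyrad.symm.le
      j (hylen ▸ hj) _ (by rw [Ideal.annihilator_quotient]; exact Ideal.le_radical)
  have hyparam : CMType.IsParameterIdeal R (Ideal.ofList ys) :=
    (CMType.isParameterIdeal_iff_ofList _).mpr ⟨ys, hylen, rfl, hyrad⟩
  -- Implications into 3 use the fixed parameters `ys`; those out of 3 use whichever parameter ideal
  -- witnesses it.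
  tfae_have 1 → 3 := fun h => ⟨_, hyparam, (CMType.faithfulSMul_quotient_iff _ M).mpr
    ((CMType.cmType_idealization_eq_iff ys hR hM hylen hyrad).mp h)⟩
  tfae_have 3 → 1 := by
    rintro ⟨q, hq, hf⟩
    obtain ⟨rs, hlen, rfl, hrad⟩ := (CMType.isParameterIdeal_iff_ofList q).mp hq
    exact (CMType.cmType_idealization_eq_iff rs hR hM hlen hrad).mpr
      ((CMType.faithfulSMul_quotient_iff _ M).mp hf)
  tfae_have 2 → 3 := fun h => ⟨_, hyparam, (CMType.faithfulSMul_quotient_iff _ M).mpr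
    (CMType.faithful_of_surjective_evalMap hK.isMCM hvan ys hylen hyrad h)⟩
  tfae_have 3 → 2 := by
    rintro ⟨q, hq, hf⟩
    obtain ⟨rs, hlen, rfl, hrad⟩ := (CMType.isParameterIdeal_iff_ofList q).mp hq
    exact CMType.surjective_evalMap_of_faithful hM hK.isMCM hvan rs hlen hrad
      ((CMType.faithfulSMul_quotient_iff _ M).mp hf)
  tfae_finish
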